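/- Let $q \ge 4$ and $n$ be integers. Let $L_q$ be the set of rankings (total orderings) of the alternatives $[q]$, viewed as permutations of $[q]$ with $x(1)$ the top-ranked alternative, $x(2)$ the second, etc. Let $f\colon L_q^n \to [q]$ be neutral, i.e. $y(f(x)) = f(y x_1,\dots,y x_n)$ for all $x \in L_q^n$ and $y \in L_q$, where $yx_i$ denotes composition of permutations. Let $\mathrm{DICT}$ be the set of functions $g\colon L_q^n \to [q]$ that depend only on the $i$-th coordinate for some $i \in [n]$, and let $\epsilon \ge 0$ be such that $$\mathrm{Dist}(f,\mathrm{DICT}) = \min_{g \in \mathrm{DICT}} \mathbf{P}(f(X) \ne g(X)) \ge \epsilon ,$$ where $X$ is uniform on $L_q^n$. Call $(x,y)\in L_q^n\times L_q^n$ a manipulation pair for $f$ if there is $i \in [n]$ such that $x$ and $y$ differ only in the $i$-th coordinate and the ranking $x_i$ prefers $f(y)$ over $f(x)$. Let $X$ be uniform on $L_q^n$, and let $Y$ be obtained from $X$ by selecting a uniform coordinate $i \in \{1,\dots,n\}$, then selecting uniformly one of the $q-3$ blocks of $4$ alternatives that are adjacent in the ranking $X_i$, and permuting these $4$ alternatives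 within $X_i$ by a uniformly random permutation, all choices being independent. Then $$\mathbf{P}\big((X,Y)\text{ is a manipulation pair for } f\big) \ \ge\ \frac{\epsilon^2}{10^{9}\, n^4\, q^{34}} .$$ -/

import Mathlib

namespace SocialChoice

/-- A ranking of `q` alternatives, as a permutation of the alternatives: `x 0` is the alternative
ranked at the top by `x`, `x 1` is the second one, and so on. -/
abbrev Ranking (q : ℕ) : Type := Equiv.Perm (Fin q)

/-- A ranking profile of `n` voters. -/
abbrev Profile (n q : ℕ) : Type := Fin n → Ranking q

/-- A social choice function for `n` voters and `q` alternatives. -/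
abbrev SCF (n q : ℕ) : Type := Profile n q → Fin q

/-- The ranking `x` prefers `a` over `b`: the rank of `a` comes strictly before the rank of `b`. -/
def Prefers {q : ℕ} (x : Ranking q) (a b : Fin q) : Prop := x.symm a < x.symm b

/-- `f` is neutral: renaming the alternatives by `y` in all rankings renames the outcome by `y`
(`y * x i` is the composition, whose top alternative is `y (x i 0)`). -/
def Neutral {n q : ℕ} (f : SCF n q) : Prop :=
  ∀ (x : Profile n q) (y : Ranking q), y (f x) = f (fun i => y * x i)

/-- `(x, y)` is a manipulation pair for `f`: the profiles differ only in the ranking of one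
voter `i`, who according to the ranking `x i` prefers the outcome at `y` over that at `x`. -/
def IsManipulationPair {n q : ℕ} (f : SCF n q) (x y : Profile n q) : Prop :=
  ∃ i : Fin n, (∀ j, j ≠ i → x j = y j) ∧ Prefers (x i) (f y) (f x)

/-- The probability of the event `p` under the uniform distribution on the finite set `Ω`. -/
noncomputable def uniformProb (Ω : Type*) [Fintype Ω] (p : Ω → Prop) : ℝ :=
  (Nat.card {ω : Ω // p ω} : ℝ) / (Fintype.card Ω : ℝ)

/-- The fraction of profiles on which `f` and `g` differ. -/
noncomputable def distance {n q : ℕ} (f g : SCF n q) : ℝ :=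
  uniformProb (Profile n q) (fun x => f x ≠ g x)

/-- The distance from `f` to a class `G` of social choice functions (a minimum, as there are only
finitely many social choice functions). -/
noncomputable def distanceTo {n q : ℕ} (f : SCF n q) (G : Set (SCF n q)) : ℝ :=
  sInf ((fun g => distance f g) '' G)

/-- The social choice functions that depend only on the coordinate `i`. -/
def DICTAt {n q : ℕ} (i : Fin n) : Set (SCF n q) :=
  {f | ∀ x y : Profile n q, x i = y i → f x = f y}

/-- The social choice functions that depend on at most one coordinate. -/
def DICT (n q : ℕ) : Set (SCF n q) := ⋃ i : Fin n, DICTAt i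

/-- The block of four adjacent ranks `k, k + 1, k + 2, k + 3`; there are `q - 3` such blocks
when `q ≥ 4`. -/
def block {q : ℕ} (k : Fin (q - 3)) : Fin 4 ↪ Fin q where
  toFun j := ⟨k.1 + j.1, by have := k.2; have := j.2; omega⟩
  inj' := by
    intro a b h
    have h' := congrArg Fin.val h
    apply Fin.ext
    simpa using h'

/-- The ranking obtained from `x` by permuting, according to `π`, the four alternatives that `x`
ranks at `k, k + 1, k + 2, k + 3`; all other alternatives keep their ranks. -/
def permuteBlock {q : ℕ} (x : Ranking q) (k : Fin (q - 3)) (π : Equiv.Perm (Fin 4)) : Ranking q :=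
  x * π.viaFintypeEmbedding (block k)

/-- The independent uniform choices made in the experiment: a profile `X`, a voter `i`, a block
of four adjacent ranks, and a permutation of four objects. -/
abbrev Sample (n q : ℕ) : Type :=
  Profile n q × Fin n × Fin (q - 3) × Equiv.Perm (Fin 4)

/-- The uniformly random profile `X`. -/
def Sample.X {n q : ℕ} (ω : Sample n q) : Profile n q := ω.1

/-- The profile `Y`, obtained from `X` by permuting the chosen block in the chosen voter's
ranking. -/
def Sample.Y {n q : ℕ} (ω : Sample n q) : Profile n q :=
  Function.update ω.1 ω.2.1 (permuteBlock (ω.1 ω.2.1) ω.2.2.1 ω.2.2.2)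

end SocialChoice

/-! Suppose manipulable profiles are rare. Since `f` is far from every function of a single
coordinate, two distinct voters `i` and `j` each have an adjacent swap that often changes the
outcome (`exists_influential`). At non-manipulable profiles such a change can only replace `a` by
`b`, where `a` and `b` are the two swapped alternatives (`eq_of_changed`). By neutrality all ordered
pairs of outcomes are equally frequent, so `i` is often pivotal for `(a, b)` and `j` for `(c, d)`,
with `a, b, c, d` distinct.

The event that `i` is pivotal for `(a, b)` is nearly determined by the other voters' preferences
between `a` and `b`: an adjacent swap by another voter that spares this pair leaves the event only
near a manipulable profile (`manipulable_of_pivotal_of_not_pivotal`). The same holds for `j` and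
`(c, d)`. The `a`-`b` preferences and the `c`-`d` preferences are independent, so the two events, if
exact, would meet with probability the product of theirs. They are disjoint, as the outcome cannot
be both `a` and `c`; hence the product is bounded by the error terms, that is, by the density of
manipulable profiles (`Neutral.sum_pivotal_mul_sum_pivotal_le`).

Replacing the events by conditional expectations makes this precise with an error linear in that
density. -/

namespace SocialChoice

open Finset Function

/-! ### Conditional expectations over classes of coordinates, and independence. -/

section Averaging

variable {n : ℕ} {L : Type*} [Fintype L]

/-- The conditional expectation of `h` given all coordinates other than `l` and the class of the
coordinate `l`, for the uniform distribution. -/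
noncomputable def avg (cls : L → Bool) (l : Fin n) (h : (Fin n → L) → ℝ) (x : Fin n → L) : ℝ :=
  (∑ u with cls u = cls (x l), h (update x l u)) / #{u | cls u = cls (x l)}

/-- Successive conditional expectations along a list of coordinates. -/
noncomputable def avgs (cls : L → Bool) (S : List (Fin n)) (h : (Fin n → L) → ℝ) :
    (Fin n → L) → ℝ :=
  S.foldr (avg cls) h

/-- `h` depends on the coordinate `l` only through its class. -/
def DependsOnClass (cls : L → Bool) (l : Fin n) (h : (Fin n → L) → ℝ) : Prop :=
  ∀ x u, cls u = cls (x l) → h (update x l u) = h x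

variable {cls : L → Bool} {l : Fin n} {h : (Fin n → L) → ℝ}

theorem card_class_pos (cls : L → Bool) (v : L) : (0 : ℝ) < #{u | cls u = cls v} := by
  exact_mod_cast card_pos.2 ⟨v, by simp⟩

theorem sum_update_swap (l : Fin n) (F : (Fin n → L) → L → ℝ) :
    ∑ x, ∑ u, F x u = ∑ x : Fin n → L, ∑ u, F (update x l u) (x l) := by
  rw [← Fintype.sum_prod_type' F, ← Fintype.sum_prod_type' (fun x u => F (update x l u) (x l))]
  have hinv : Involutive (fun p : (Fin n → L) × L => (update p.1 l p.2, p.1 l)) := by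
    rintro ⟨x, u⟩; simp
  exact (Equiv.sum_comp (Involutive.toPerm _ hinv) (fun p : (Fin n → L) × L => F p.1 p.2)).symm

theorem sum_avg : ∑ x, avg cls l h x = ∑ x, h x := by
  have h1 : ∀ x, avg cls l h x = ∑ u, if cls u = cls (x l) then
      h (update x l u) / (#{v | cls v = cls (x l)} : ℝ) else 0 := by
    intro x
    rw [avg, sum_div, sum_filter]
  simp_rw [h1]
  rw [sum_update_swap l]
  refine sum_congr rfl fun x _ => ?_
  have h2 : ∀ u, (if cls (x l) = cls (update x l u l) then
      h (update (update x l u) l (x l)) / (#{v | cls v = cls (update x l u l)} : ℝ) else 0)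
      = if cls u = cls (x l) then h x / (#{v | cls v = cls (x l)} : ℝ) else 0 := by
    intro u
    by_cases hu : cls u = cls (x l) <;> simp [hu, eq_comm]
  simp_rw [h2]
  rw [← sum_filter, sum_const, nsmul_eq_mul]
  have := card_class_pos cls (x l)
  field_simp

theorem avg_nonneg (h0 : ∀ x, 0 ≤ h x) (x) : 0 ≤ avg cls l h x :=
  div_nonneg (sum_nonneg fun _ _ => h0 _) (Nat.cast_nonneg _)

theorem avg_le_one (h1 : ∀ x, h x ≤ 1) (x) : avg cls l h x ≤ 1 := by
  rw [avg, div_le_one (card_class_pos cls (x l))]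
  exact (sum_le_sum fun _ _ => h1 _).trans (by simp)

theorem avgs_nonneg (S : List (Fin n)) (h0 : ∀ x, 0 ≤ h x) : ∀ x, 0 ≤ avgs cls S h x := by
  induction S with
  | nil => exact h0
  | cons l S ih => exact avg_nonneg ih

theorem avgs_le_one (S : List (Fin n)) (h1 : ∀ x, h x ≤ 1) : ∀ x, avgs cls S h x ≤ 1 := by
  induction S with
  | nil => exact h1
  | cons l S ih => exact avg_le_one ih

theorem sum_avgs (S : List (Fin n)) : ∑ x, avgs cls S h x = ∑ x, h x := by
  induction S with
  | nil => rfl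
  | cons l S ih => exact sum_avg.trans ih

/-- A union bound: to pass from outside the set with indicator `h` to inside it by resampling
coordinates one at a time, some single resampling must enter the set. -/
theorem sum_one_sub_mul_avgs_le (hh : ∀ x, h x = 0 ∨ h x = 1) (S : List (Fin n)) :
    ∑ x, (1 - h x) * avgs cls S h x ≤
      (S.map fun l => ∑ x, (1 - h x) * avg cls l h x).sum := by
  have h0 : ∀ x, 0 ≤ h x := fun x => by rcases hh x with hx | hx <;> simp [hx]
  have h1 : ∀ x, h x ≤ 1 := fun x => by rcases hh x with hx | hx <;> simp [hx]
  induction S with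
  | nil =>
    refine sum_nonpos fun x _ => ?_
    rcases hh x with hx | hx <;> simp [avgs, hx]
  | cons l S ih =>
    rw [List.map_cons, List.sum_cons]
    refine le_trans ?_ (add_le_add_right ih _)
    rw [← sum_avg (cls := cls) (l := l) (h := fun x => (1 - h x) * avgs cls S h x),
      ← sum_add_distrib]
    refine sum_le_sum fun x _ => ?_
    change (1 - h x) * avg cls l (avgs cls S h) x ≤ _
    simp only [avg]
    rw [← mul_div_assoc, ← mul_div_assoc, ← add_div]
    refine div_le_div_of_nonneg_right ?_ (Nat.cast_nonneg _)
    rw [mul_sum, mul_sum, ← sum_add_distrib]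
    refine sum_le_sum fun u _ => ?_
    have a0 := h0 x
    have a1 := h1 x
    have b0 := h0 (update x l u)
    have b1 := h1 (update x l u)
    have c0 := avgs_nonneg (cls := cls) S h0 (update x l u)
    have c1 := avgs_le_one (cls := cls) S h1 (update x l u)
    -- With `a`, `b`, `c` for `h x`, `h (update x l u)`, `avgs cls S h (update x l u)`: right minus
    -- left equals `(1 - a) b (1 - c) + a (1 - b) c`.
    nlinarith [mul_nonneg (sub_nonneg.2 a1) (mul_nonneg b0 (sub_nonneg.2 c1)),
      mul_nonneg a0 (mul_nonneg (sub_nonneg.2 b1) c0)]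

theorem dependsOnClass_avg : DependsOnClass cls l (avg cls l h) := by
  intro x u hu
  simp [avg, hu]

theorem DependsOnClass.avg {cls' : L → Bool} {m : Fin n} (hm : DependsOnClass cls' m h)
    (hlm : m ≠ l) : DependsOnClass cls' m (avg cls l h) := by
  intro x u hu
  simp only [SocialChoice.avg, update_of_ne hlm.symm]
  congr 1
  refine sum_congr rfl fun v _ => ?_
  rw [update_comm hlm]
  exact hm _ _ (by rwa [update_of_ne hlm])

theorem dependsOnClass_avgs {S : List (Fin n)} {m : Fin n} (hm : m ∈ S) :
    DependsOnClass cls m (avgs cls S h) := by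
  induction S with
  | nil => simp at hm
  | cons l S ih =>
    by_cases hml : m = l
    · subst hml; exact dependsOnClass_avg
    · exact (ih ((List.mem_cons.1 hm).resolve_left hml)).avg hml

theorem avg_mul_of_dependsOnClass {g : (Fin n → L) → ℝ} (hg : DependsOnClass cls l g) (x) :
    avg cls l (fun y => h y * g y) x = avg cls l h x * g x := by
  simp only [avg]
  rw [div_mul_eq_mul_div, sum_mul]
  congr 1
  refine sum_congr rfl fun u hu => ?_
  rw [hg x u (mem_filter.1 hu).2]

omit [Fintype L] in
theorem eq_of_dependsOnClass {c : Fin n → L → Bool} (hc : ∀ l, DependsOnClass (c l) l h)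
    {x y : Fin n → L} (hxy : ∀ l, c l (y l) = c l (x l)) : h y = h x := by
  have key : ∀ S : Finset (Fin n), h (S.piecewise y x) = h x := by
    intro S
    induction S using Finset.induction with
    | empty => simp
    | insert j S hj ih =>
      rw [piecewise_insert, hc j, ih]
      rw [piecewise_eq_of_notMem _ _ _ hj]; exact hxy j
  simpa using key univ

theorem avg_comp {e : L ≃ L} (hcls : ∀ u v, cls (e u) = cls (e v) ↔ cls u = cls v)
    (hh : ∀ x, h (fun l => e (x l)) = h x) (x) :
    avg cls l h (fun l => e (x l)) = avg cls l h x := by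
  simp only [avg]
  congr 1
  · rw [sum_filter, sum_filter, ← Equiv.sum_comp e]
    refine sum_congr rfl fun u _ => ?_
    simp only [hcls]
    rw [← hh (update x l u)]
    congr 2
    funext m
    by_cases hm : m = l
    · subst hm; simp
    · simp [hm]
  · norm_cast
    refine card_equiv e.symm fun u => ?_
    rw [mem_filter_univ, mem_filter_univ, ← hcls (e.symm u), Equiv.apply_symm_apply]

theorem avgs_comp {e : L ≃ L} (hcls : ∀ u v, cls (e u) = cls (e v) ↔ cls u = cls v)
    (hh : ∀ x, h (fun l => e (x l)) = h x) (S : List (Fin n)) :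
    ∀ x, avgs cls S h (fun l => e (x l)) = avgs cls S h x := by
  induction S with
  | nil => exact hh
  | cons l S ih => exact avg_comp hcls ih

/-- Averaging over the class `cls₁` off the coordinate `i` and over the class `cls₂` on it gives a
function of the classes `cls₁` off `i`, if `h` is invariant under a relabelling that preserves
`cls₁` and flips `cls₂`. -/
theorem avg_avgs_eq {cls₁ cls₂ : L → Bool} {e : L ≃ L} (he₁ : ∀ u, cls₁ (e u) = cls₁ u)
    (he₂ : ∀ u, cls₂ (e u) = !cls₂ u) (hh : ∀ x, h (fun l => e (x l)) = h x) {i : Fin n}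
    {S : List (Fin n)} (hS : ∀ l, l ≠ i → l ∈ S) {x y : Fin n → L}
    (hxy : ∀ l, l ≠ i → cls₁ (y l) = cls₁ (x l)) :
    avg cls₂ i (avgs cls₁ S h) y = avg cls₂ i (avgs cls₁ S h) x := by
  set G := avg cls₂ i (avgs cls₁ S h) with hG
  have hGe : ∀ x, G (fun l => e (x l)) = G x :=
    avg_comp (by simp [he₂]) (avgs_comp (by simp [he₁]) hh S)
  have hdep : ∀ l, DependsOnClass (if l = i then cls₂ else cls₁) l G := by
    intro l
    split_ifs with hl
    · subst hl; exact dependsOnClass_avg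
    · exact (dependsOnClass_avgs (hS l hl)).avg hl
  by_cases hi : cls₂ (y i) = cls₂ (x i)
  · refine eq_of_dependsOnClass hdep fun l => ?_
    split_ifs with hl
    · subst hl; exact hi
    · exact hxy l hl
  -- The classes at `i` disagree, so `x` is first relabelled by `e`, which corrects `cls₂` at `i`
  -- and leaves `cls₁` alone.
  · rw [← hGe x]
    refine eq_of_dependsOnClass hdep fun l => ?_
    split_ifs with hl
    · subst hl
      rw [he₂]
      revert hi
      cases cls₂ (y l) <;> cases cls₂ (x l) <;> simp
    · rw [he₁]; exact hxy l hl

/-- Functions of the classes `cls₁` and of the classes `cls₂` are independent, if there is an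
involution that preserves `cls₁` and flips `cls₂`. -/
theorem sum_mul_sum_of_flip {cls₁ cls₂ : L → Bool} {e : L → L} (hinv : Involutive e)
    (he₁ : ∀ u, cls₁ (e u) = cls₁ u) (he₂ : ∀ u, cls₂ (e u) = !cls₂ u)
    {g g' : (Fin n → L) → ℝ} (hg : ∀ x y, (∀ l, cls₁ (y l) = cls₁ (x l)) → g y = g x)
    (hg' : ∀ x y, (∀ l, cls₂ (y l) = cls₂ (x l)) → g' y = g' x) :
    (∑ x, g x) * ∑ x, g' x = Fintype.card (Fin n → L) * ∑ x, g x * g' x := by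
  -- The hybrid `t x y` has the `cls₁` classes of `x` and the `cls₂` classes of `y`. The map `(x, y)
  -- ↦ (t x y, t y x)` is an involution and turns `g x * g' y` into a product at one point.
  let t : (Fin n → L) → (Fin n → L) → Fin n → L :=
    fun x y l => if cls₂ (x l) = cls₂ (y l) then x l else e (x l)
  have ht2 : ∀ x y l, cls₂ (t x y l) = cls₂ (y l) := by
    intro x y l
    simp only [t]
    split_ifs with hl
    · exact hl
    · rw [he₂]; revert hl
      cases cls₂ (y l) <;> cases cls₂ (x l) <;> simp
  have ht1 : ∀ x y l, cls₁ (t x y l) = cls₁ (x l) := by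
    intro x y l
    simp only [t]
    split_ifs with hl
    · rfl
    · exact he₁ _
  have htt : ∀ x y, t (t x y) (t y x) = x := by
    intro x y
    funext l
    have : t (t x y) (t y x) l = if cls₂ (y l) = cls₂ (x l) then t x y l else e (t x y l) := by
      change (if cls₂ (t x y l) = cls₂ (t y x l) then t x y l else e (t x y l)) = _
      rw [ht2, ht2]
    rw [this]
    by_cases hl : cls₂ (x l) = cls₂ (y l)
    · simp [t, hl]
    · simp [t, hl, Ne.symm hl, hinv (x l)]
  have hT : Involutive (fun p : (Fin n → L) × (Fin n → L) => (t p.1 p.2, t p.2 p.1)) := by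
    rintro ⟨x, y⟩
    simp only [htt]
  rw [sum_mul_sum, ← Fintype.sum_prod_type' (fun x y => g x * g' y)]
  have h1 : ∀ p : (Fin n → L) × (Fin n → L), g p.1 * g' p.2 =
      (fun p : (Fin n → L) × (Fin n → L) => g p.1 * g' p.1) ((Involutive.toPerm _ hT) p) := by
    rintro ⟨x, y⟩
    change g x * g' y = g (t x y) * g' (t x y)
    rw [hg x _ (ht1 x y), hg' y _ (ht2 x y)]
  simp_rw [h1]
  rw [Equiv.sum_comp (Involutive.toPerm _ hT) (fun p : (Fin n → L) × (Fin n → L) => g p.1 * g' p.1),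
    Fintype.sum_prod_type' (fun x (_ : Fin n → L) => g x * g' x)]
  simp [mul_sum]

end Averaging

/-! ### Bubble sort. -/

section AdjacentSwaps

variable {q : ℕ}

theorem exists_descent {τ : Equiv.Perm (Fin q)} (hτ : τ ≠ 1) :
    ∃ u v : Fin q, (u : ℕ) + 1 = v ∧ τ v < τ u := by
  by_contra! hcon
  apply hτ
  cases q with
  | zero => exact Subsingleton.elim _ _
  | succ q =>
    have hmono : StrictMono τ := by
      refine Fin.strictMono_iff_lt_succ.2 fun i => ?_
      refine lt_of_le_of_ne (hcon _ _ (by simp)) fun hne => ?_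
      exact (Fin.castSucc_lt_succ (i := i)).ne (τ.injective hne)
    ext1 x
    have : ⇑τ = id := (hmono.range_inj strictMono_id).1 (by simp [τ.surjective.range_eq])
    simp [this]

/-- The rearrangement inequality for one swap: this sum is the potential that makes bubble sort
terminate. -/
theorem sum_mul_swap_lt (τ : Equiv.Perm (Fin q)) {u v : Fin q} (huv : (u : ℕ) + 1 = v)
    (h : τ v < τ u) :
    ∑ p : Fin q, (p : ℕ) * (τ p : ℕ) < ∑ p : Fin q, (p : ℕ) * ((τ * Equiv.swap u v) p : ℕ) := by
  have hne : u ≠ v := by rintro rfl; omega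
  have hsplit : ∀ F : Fin q → ℕ, ∑ p, F p = F u + F v + ∑ p ∈ univ \ {u, v}, F p := by
    intro F
    rw [← sum_pair hne, add_comm, sum_sdiff (subset_univ _)]
  rw [hsplit, hsplit]
  have hrest : ∑ p ∈ univ \ {u, v}, (p : ℕ) * ((τ * Equiv.swap u v) p : ℕ) =
      ∑ p ∈ univ \ {u, v}, (p : ℕ) * (τ p : ℕ) := by
    refine sum_congr rfl fun p hp => ?_
    simp only [mem_sdiff, mem_univ, true_and, mem_insert, mem_singleton, not_or] at hp
    simp [Equiv.swap_apply_of_ne_of_ne hp.1 hp.2]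
  rw [hrest]
  simp only [Equiv.Perm.coe_mul, comp_apply, Equiv.swap_apply_left, Equiv.swap_apply_right, ← huv]
  have h' : (τ v : ℕ) < τ u := h
  nlinarith

/-- A quantity that grows by at most `η` per adjacent swap of a bubble sort. -/
theorem le_of_adjacent_swap_le {F : Equiv.Perm (Fin q) → ℝ} {η : ℝ} (hη : 0 ≤ η) (h1 : F 1 ≤ 0)
    (hstep : ∀ σ : Equiv.Perm (Fin q), ∀ u v : Fin q, (u : ℕ) + 1 = v → σ.symm v < σ.symm u →
      F σ ≤ η + F (Equiv.swap u v * σ)) (σ : Equiv.Perm (Fin q)) : F σ ≤ (q : ℝ) ^ 3 * η := by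
  -- The potential is a natural number that rises at every swap, so its upper bound `q ^ 3` also
  -- bounds the number of swaps.
  have hbound : ∀ σ : Equiv.Perm (Fin q), ∑ p : Fin q, (p : ℕ) * (σ.symm p : ℕ) ≤ q ^ 3 := by
    intro σ
    calc ∑ p : Fin q, (p : ℕ) * (σ.symm p : ℕ) ≤ ∑ _p : Fin q, q * q :=
          sum_le_sum fun p _ => Nat.mul_le_mul p.2.le (σ.symm p).2.le
      _ = q ^ 3 := by simp; ring
  have key : ∀ k : ℕ, ∀ σ : Equiv.Perm (Fin q), q ^ 3 - ∑ p : Fin q, (p : ℕ) * (σ.symm p : ℕ) ≤ k →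
      F σ ≤ k * η := by
    intro k
    induction k with
    | zero =>
      intro σ hσ
      by_cases h : σ = 1
      · subst h; simpa using h1
      · obtain ⟨u, v, huv, hlt⟩ := exists_descent (τ := σ.symm) (by
          intro h'; apply h; ext1 x; rw [← Equiv.eq_symm_apply, h']; rfl)
        have := sum_mul_swap_lt σ.symm huv hlt
        have h2 := hbound (Equiv.swap u v * σ)
        have h3 : (Equiv.swap u v * σ).symm = σ.symm * Equiv.swap u v := by
          ext1 x; rw [Equiv.symm_apply_eq]; simp
        rw [h3] at h2
        omega
    | succ k ih =>
      intro σ hσ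
      by_cases h : σ = 1
      · subst h; exact h1.trans (by positivity)
      · obtain ⟨u, v, huv, hlt⟩ := exists_descent (τ := σ.symm) (by
          intro h'; apply h; ext1 x; rw [← Equiv.eq_symm_apply, h']; rfl)
        have := sum_mul_swap_lt σ.symm huv hlt
        have h3 : (Equiv.swap u v * σ).symm = σ.symm * Equiv.swap u v := by
          ext1 x; rw [Equiv.symm_apply_eq]; simp
        have h4 := ih (Equiv.swap u v * σ) (by rw [h3]; omega)
        have h5 := hstep σ u v huv hlt
        push_cast
        linarith
  simpa using key (q ^ 3) σ (Nat.sub_le _ _)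

end AdjacentSwaps

/-! ### Influential swaps and the distance to functions of one coordinate. -/

section Influence

open Classical in
/-- The indicator of a proposition. -/
noncomputable def ind (p : Prop) : ℝ := if p then 1 else 0

theorem ind_nonneg (p : Prop) : 0 ≤ ind p := by
  unfold ind; split_ifs <;> norm_num

theorem ind_le_one (p : Prop) : ind p ≤ 1 := by
  unfold ind; split_ifs <;> norm_num

theorem ind_of {p : Prop} (h : p) : ind p = 1 := if_pos h

theorem ind_of_not {p : Prop} (h : ¬ p) : ind p = 0 := if_neg h

theorem ind_le_of_imp {p : Prop} {t : ℝ} (ht : 0 ≤ t) (h : p → 1 ≤ t) : ind p ≤ t := by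
  unfold ind; split_ifs with hp
  exacts [h hp, ht]

theorem uniformProb_eq {Ω : Type*} [Fintype Ω] (p : Ω → Prop) :
    uniformProb Ω p = (∑ x, ind (p x)) / Fintype.card Ω := by
  classical
  rw [uniformProb, Nat.card_eq_fintype_card, Fintype.card_subtype]
  simp [ind]

/-- The profile with the ranking `σ` at the coordinate `j` and the identity elsewhere; the right
multiplication by it permutes the ranks of the voter `j`. -/
def single {n q : ℕ} (j : Fin n) (σ : Ranking q) : Profile n q := Pi.mulSingle j σ

theorem single_one {n q : ℕ} (j : Fin n) : single j (1 : Ranking q) = 1 := Pi.mulSingle_one j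

theorem single_mul {n q : ℕ} (j : Fin n) (σ τ : Ranking q) :
    single j (σ * τ) = single j σ * single j τ :=
  Pi.mulSingle_mul (f := fun _ : Fin n => Ranking q) j σ τ

theorem mul_single_same {n q : ℕ} (x : Profile n q) (j : Fin n) (σ : Ranking q) :
    (x * single j σ) j = x j * σ := by simp [single]

theorem mul_single_of_ne {n q : ℕ} (x : Profile n q) {j m : Fin n} (h : m ≠ j) (σ : Ranking q) :
    (x * single j σ) m = x m := by simp [single, h]

theorem mul_single_eq_update {n q : ℕ} (x : Profile n q) (j : Fin n) (σ : Ranking q) :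
    x * single j σ = update x j (x j * σ) := by
  funext m
  by_cases hm : m = j
  · subst hm; rw [mul_single_same, update_self]
  · rw [mul_single_of_ne x hm, update_of_ne hm]

variable {n q : ℕ} (f : SCF n q)

/-- The number of profiles whose outcome is changed by the right multiplication by `g`. -/
noncomputable def changes (g : Profile n q) : ℝ := ∑ x, ind (f x ≠ f (x * g))

theorem changes_one : changes f 1 = 0 := by simp [changes, ind]

theorem changes_mul_le (g g' : Profile n q) :
    changes f (g * g') ≤ changes f g + changes f g' := by
  have h : changes f g' = ∑ x, ind (f (x * g) ≠ f ((x * g) * g')) :=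
    (Equiv.sum_comp (Equiv.mulRight g) (fun x => ind (f x ≠ f (x * g')))).symm
  rw [h, changes, changes, ← sum_add_distrib]
  refine sum_le_sum fun x _ => ?_
  simp only [mul_assoc]
  refine ind_le_of_imp (add_nonneg (ind_nonneg _) (ind_nonneg _)) fun h => ?_
  by_cases h1 : f x = f (x * g)
  · rw [ind_of (p := f (x * g) ≠ f (x * (g * g'))) (h1 ▸ h)]
    linarith [ind_nonneg (f x ≠ f (x * g))]
  · rw [ind_of h1]
    linarith [ind_nonneg (f (x * g) ≠ f (x * (g * g')))]

theorem changes_mulSingle_le {j : Fin n} {η : ℝ} (hη : 0 ≤ η)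
    (h : ∀ u v : Fin q, (u : ℕ) + 1 = v → changes f (single j (Equiv.swap u v)) ≤ η)
    (σ : Ranking q) : changes f (single j σ) ≤ (q : ℝ) ^ 3 * η := by
  refine le_of_adjacent_swap_le (F := fun σ => changes f (single j σ)) hη
    (by simp [single_one, changes_one]) (fun σ u v huv _ => ?_) σ
  have h1 : σ = Equiv.swap u v * (Equiv.swap u v * σ) := by simp [← mul_assoc]
  calc changes f (single j σ)
      = changes f (single j (Equiv.swap u v) * single j (Equiv.swap u v * σ)) := by
        rw [← single_mul, ← h1]
    _ ≤ _ := (changes_mul_le f _ _).trans (add_le_add_left (h u v huv) _)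

theorem changes_le_card_mul {K : ℝ} (S : Finset (Fin n))
    (h : ∀ j ∈ S, ∀ σ, changes f (single j σ) ≤ K) :
    ∀ τ : Profile n q, (∀ j, j ∉ S → τ j = 1) → changes f τ ≤ #S * K := by
  induction S using Finset.induction with
  | empty =>
    intro τ hτ
    have : τ = 1 := funext fun j => hτ j (by simp)
    simp [this, changes_one]
  | insert j S hj ih =>
    intro τ hτ
    have h1 : τ = single j (τ j) * update τ j 1 := by
      funext m
      by_cases hm : m = j
      · subst hm; simp [single]
      · simp [single, hm]
    have h2 := ih (fun m hm => h m (mem_insert_of_mem hm)) (update τ j 1) (by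
      intro m hm
      by_cases hmj : m = j
      · subst hmj; simp
      · rw [update_of_ne hmj]; exact hτ m (by simp [hmj, hm]))
    have h3 := h j (mem_insert_self _ _) (τ j)
    rw [h1, card_insert_of_notMem hj]
    push_cast
    linarith [changes_mul_le f (single j (τ j)) (update τ j 1)]

/-- If no adjacent swap outside of the coordinate `i` is influential, then `f` is close to a
function of the coordinate `i`. -/
theorem distanceTo_DICT_le (i : Fin n) {η : ℝ} (hη : 0 ≤ η)
    (h : ∀ j, j ≠ i → ∀ u v : Fin q, (u : ℕ) + 1 = v →
      changes f (single j (Equiv.swap u v)) ≤ η) :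
    distanceTo f (DICT n q) * Fintype.card (Profile n q) ≤ n * ((q : ℝ) ^ 3 * η) := by
  have hK : ∀ τ : Profile n q, changes f (update τ i 1) ≤ n * ((q : ℝ) ^ 3 * η) := by
    intro τ
    refine (changes_le_card_mul f (univ.erase i) (K := (q : ℝ) ^ 3 * η) (fun j hj σ =>
      changes_mulSingle_le f hη (h j (ne_of_mem_erase hj)) σ) _ fun j hj => ?_).trans ?_
    · have : j = i := by simpa using hj
      subst this; simp
    · have : (#(univ.erase i) : ℝ) ≤ n := by
        exact_mod_cast (card_le_univ _).trans (by simp)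
      gcongr
  -- The candidates for a close function freeze all coordinates but `i` at those of a random profile
  -- `w`; some `w` does at least as well as the average.
  have havg : ∑ w : Profile n q, ∑ x, ind (f x ≠ f (update w i (x i))) ≤
      ∑ _w : Profile n q, n * ((q : ℝ) ^ 3 * η) := by
    rw [sum_comm]
    have h1 : ∀ x : Profile n q, ∑ w, ind (f x ≠ f (update w i (x i))) =
        ∑ τ, ind (f x ≠ f (x * update τ i 1)) := by
      intro x
      rw [← Equiv.sum_comp (Equiv.mulLeft x)]
      refine sum_congr rfl fun τ _ => ?_
      have : update (x * τ) i (x i) = x * update τ i 1 := by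
        funext m
        by_cases hm : m = i
        · subst hm; simp
        · simp [hm]
      rw [Equiv.coe_mulLeft, this]
    simp_rw [h1]
    rw [sum_comm]
    exact sum_le_sum fun τ _ => hK τ
  obtain ⟨w, -, hw⟩ := exists_le_of_sum_le ⟨1, mem_univ _⟩ havg
  have hN : (0 : ℝ) < Fintype.card (Profile n q) := by exact_mod_cast Fintype.card_pos
  have hle : distanceTo f (DICT n q) ≤ distance f (fun x => f (update w i (x i))) := by
    refine csInf_le ⟨0, ?_⟩ ⟨_, ?_, rfl⟩
    · rintro _ ⟨g, -, rfl⟩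
      exact div_nonneg (Nat.cast_nonneg _) (Nat.cast_nonneg _)
    · refine Set.mem_iUnion.2 ⟨i, fun x y hxy => ?_⟩
      change f _ = f _
      rw [hxy]
  refine le_trans ?_ hw
  rw [distance, uniformProb_eq, le_div_iff₀ hN] at hle
  exact hle

end Influence

/-! ### Local consequences of non-manipulability. -/

section Manipulation

variable {n q : ℕ} (f : SCF n q)

/-- Some voter can manipulate `f` at `x` by permuting four adjacent alternatives. -/
def Manipulable (x : Profile n q) : Prop :=
  ∃ i k π, IsManipulationPair f x (update x i (permuteBlock (x i) k π))

theorem viaFintypeEmbedding_swap {α β : Type*} [Fintype α] [DecidableEq α] [DecidableEq β]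
    (e : α ↪ β) (i j : α) :
    (Equiv.swap i j).viaFintypeEmbedding e = Equiv.swap (e i) (e j) := by
  ext1 b
  by_cases hb : b ∈ Set.range e
  · obtain ⟨a, rfl⟩ := hb
    rw [Equiv.Perm.viaFintypeEmbedding_apply_image, e.injective.swap_apply]
  · rw [Equiv.Perm.viaFintypeEmbedding_apply_notMem_range _ _ hb]
    exact (Equiv.swap_apply_of_ne_of_ne (fun h => hb ⟨i, h.symm⟩) (fun h => hb ⟨j, h.symm⟩)).symm

theorem exists_permuteBlock_eq (hq : 4 ≤ q) {u v : Fin q} (huv : (u : ℕ) + 1 = v) :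
    ∃ k π, ∀ σ : Ranking q, permuteBlock σ k π = σ * Equiv.swap u v := by
  have hu := u.2
  have hv := v.2
  -- The block starts at `u`, or is the last block when `u` is among the bottom ranks.
  let k : Fin (q - 3) := ⟨min (u : ℕ) (q - 4), by omega⟩
  refine ⟨k, Equiv.swap ⟨(u : ℕ) - min (u : ℕ) (q - 4), by omega⟩ ⟨(v : ℕ) - min (u : ℕ) (q - 4), by omega⟩, fun σ => ?_⟩
  rw [permuteBlock, viaFintypeEmbedding_swap]
  congr 2
  · apply Fin.ext
    change min (u : ℕ) (q - 4) + ((u : ℕ) - min (u : ℕ) (q - 4)) = u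
    omega
  · apply Fin.ext
    change min (u : ℕ) (q - 4) + ((v : ℕ) - min (u : ℕ) (q - 4)) = v
    omega

variable {f}

theorem not_prefers_of_not_manipulable (hq : 4 ≤ q) {x : Profile n q} (hx : ¬ Manipulable f x)
    (l : Fin n) {u v : Fin q} (huv : (u : ℕ) + 1 = v) :
    ¬ Prefers (x l) (f (x * single l (Equiv.swap u v))) (f x) := by
  obtain ⟨k, π, hk⟩ := exists_permuteBlock_eq hq huv
  intro h
  refine hx ⟨l, k, π, l, fun j hj => (update_of_ne hj _ _).symm, ?_⟩
  rwa [hk, ← mul_single_eq_update]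

theorem mul_swap_symm_apply (σ : Ranking q) (u v c : Fin q) :
    (σ * Equiv.swap u v).symm c = Equiv.swap u v (σ.symm c) := by
  rw [Equiv.symm_apply_eq]; simp

theorem swap_lt_swap_iff {u v α β : Fin q} (huv : (u : ℕ) + 1 = v)
    (h1 : ¬ (α = u ∧ β = v)) (h2 : ¬ (α = v ∧ β = u)) :
    Equiv.swap u v α < Equiv.swap u v β ↔ α < β := by
  rw [Fin.lt_def, Fin.lt_def, Equiv.swap_apply_def, Equiv.swap_apply_def]
  simp only [Fin.ext_iff] at *
  split_ifs <;> omega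

theorem mul_single_swap_swap (x : Profile n q) (l : Fin n) (u v : Fin q) :
    x * single l (Equiv.swap u v) * single l (Equiv.swap u v) = x := by
  rw [mul_assoc, ← single_mul, Equiv.swap_mul_self, single_one, mul_one]

theorem mul_single_comm (x : Profile n q) {i l : Fin n} (hil : i ≠ l) (σ τ : Ranking q) :
    x * single i σ * single l τ = x * single l τ * single i σ := by
  funext m
  by_cases hi : m = i
  · subst hi; simp [single, hil]
  · by_cases hl : m = l
    · subst hl; simp [single, hil.symm]
    · simp [single, hi, hl]

/-- An adjacent swap that changes the outcome of a non-manipulable profile swaps the two outcomes,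
in favour of the new one. -/
theorem eq_of_changed (hq : 4 ≤ q) {x : Profile n q} {l : Fin n} {u v : Fin q}
    (huv : (u : ℕ) + 1 = v) (hx : ¬ Manipulable f x)
    (hy : ¬ Manipulable f (x * single l (Equiv.swap u v)))
    (hne : f x ≠ f (x * single l (Equiv.swap u v))) :
    x l u = f x ∧ x l v = f (x * single l (Equiv.swap u v)) := by
  have h1 := not_prefers_of_not_manipulable hq hx l huv
  have h2 := not_prefers_of_not_manipulable hq hy l huv
  rw [mul_single_swap_swap] at h2
  unfold Prefers at h1 h2
  rw [mul_single_same, mul_swap_symm_apply, mul_swap_symm_apply] at h2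
  have hne' : (x l).symm (f x) ≠ (x l).symm (f (x * single l (Equiv.swap u v))) :=
    fun h => hne ((x l).symm.injective h)
  rw [← Equiv.eq_symm_apply, ← Equiv.eq_symm_apply]
  have hlt := lt_of_le_of_ne (not_lt.1 h1) hne'
  by_contra hcon
  by_cases h3 : (x l).symm (f x) = v ∧ (x l).symm (f (x * single l (Equiv.swap u v))) = u
  · rw [h3.1, h3.2, Fin.lt_def] at hlt; omega
  · exact h2 ((swap_lt_swap_iff huv (fun h => hcon ⟨h.1.symm, h.2.symm⟩) h3).2 hlt)

/-- The outcome is `a` and the adjacent swap of `a` with `b` by the voter `i` changes it to `b`. -/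
def Pivotal (f : SCF n q) (i : Fin n) (u v a b : Fin q) (x : Profile n q) : Prop :=
  x i u = a ∧ x i v = b ∧ f x = a ∧ f (x * single i (Equiv.swap u v)) = b

/-- Consider the square formed by the swaps of `i` and `l`. If no corner is manipulable,
`eq_of_changed` governs every edge. Both edges of `l` cannot change the outcome, since the
alternative at rank `s` would be both `a` and `b`. If just one does, either the outcomes on the far
edge of `i` agree, and `l` swaps `a` with `b`, or they differ, and must be `a` and `b` after all. -/
theorem manipulable_of_pivotal_of_not_pivotal (hq : 4 ≤ q) {i l : Fin n} (hil : i ≠ l)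
    {u v s t a b : Fin q} (huv : (u : ℕ) + 1 = v) (hst : (s : ℕ) + 1 = t) {x : Profile n q}
    (hx : Pivotal f i u v a b x) (hy : ¬ Pivotal f i u v a b (x * single l (Equiv.swap s t)))
    (h1 : ¬ (x l s = a ∧ x l t = b)) (h2 : ¬ (x l s = b ∧ x l t = a)) :
    Manipulable f x ∨ Manipulable f (x * single l (Equiv.swap s t)) ∨
      Manipulable f (x * single i (Equiv.swap u v)) ∨
      Manipulable f (x * single l (Equiv.swap s t) * single i (Equiv.swap u v)) := by
  by_contra! hcon
  obtain ⟨m1, m2, m3, m4⟩ := hcon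
  obtain ⟨hu, hv, ha, hb⟩ := hx
  have huv' : u ≠ v := by rintro rfl; omega
  have hab : a ≠ b := by rw [← hu, ← hv]; exact fun h => huv' ((x i).injective h)
  set y := x * single l (Equiv.swap s t) with hy_def
  have hyi : y i = x i := mul_single_of_ne x hil _
  have hxl : (x * single i (Equiv.swap u v)) l = x l := mul_single_of_ne x hil.symm _
  have hcomm : y * single i (Equiv.swap u v) =
      x * single i (Equiv.swap u v) * single l (Equiv.swap s t) :=
    (mul_single_comm x hil _ _).symm
  have cx := fun hne => eq_of_changed hq hst m1 m2 hne
  have cx' := fun hne => eq_of_changed hq hst m3 (hcomm ▸ m4) hne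
  have cy := fun hne => eq_of_changed hq huv m2 m4 hne
  rw [← hcomm, hb, hxl] at cx'
  rw [← hy_def, ha] at cx
  rw [hyi, hu, hv] at cy
  have hfy : ¬ (f y = a ∧ f (y * single i (Equiv.swap u v)) = b) :=
    fun h => hy ⟨by rw [hyi, hu], by rw [hyi, hv], h.1, h.2⟩
  by_cases hya : f y = a
  · by_cases hyb : f (y * single i (Equiv.swap u v)) = b
    · exact hfy ⟨hya, hyb⟩
    · obtain ⟨-, c2⟩ := cx' (Ne.symm hyb)
      obtain ⟨c3, -⟩ := cx' (Ne.symm hyb)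
      by_cases h : f y = f (y * single i (Equiv.swap u v))
      · exact h2 ⟨c3, by rw [c2, ← h, hya]⟩
      · exact hyb (cy h).2.symm
  · obtain ⟨c1, c2⟩ := cx (Ne.symm hya)
    by_cases hyb : b = f (y * single i (Equiv.swap u v))
    · by_cases h : f y = f (y * single i (Equiv.swap u v))
      · exact h1 ⟨c1, by rw [c2, h, ← hyb]⟩
      · exact hya (cy h).1.symm
    · exact hab (c1.symm.trans (cx' hyb).1)

/-- Whether a ranking prefers `a` over `b`. -/
def pref (a b : Fin q) (σ : Ranking q) : Bool := decide (σ.symm a < σ.symm b)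

theorem swap_mul_symm_apply (σ : Ranking q) (c d a : Fin q) :
    (Equiv.swap c d * σ).symm a = σ.symm (Equiv.swap c d a) := by
  rw [Equiv.symm_apply_eq]; simp

theorem pref_swap_mul_of_ne {a b c d : Fin q} (hac : a ≠ c) (had : a ≠ d) (hbc : b ≠ c)
    (hbd : b ≠ d) (σ : Ranking q) : pref a b (Equiv.swap c d * σ) = pref a b σ := by
  simp only [pref, swap_mul_symm_apply, Equiv.swap_apply_of_ne_of_ne hac had,
    Equiv.swap_apply_of_ne_of_ne hbc hbd]

theorem pref_swap_mul_self {a b : Fin q} (hab : a ≠ b) (σ : Ranking q) :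
    pref a b (Equiv.swap a b * σ) = !pref a b σ := by
  have hne : σ.symm a ≠ σ.symm b := fun h => hab (σ.symm.injective h)
  simp only [pref, swap_mul_symm_apply, Equiv.swap_apply_left, Equiv.swap_apply_right]
  rcases lt_or_gt_of_ne hne with h | h <;> simp [h, h.not_gt]

theorem card_pref_class {a b : Fin q} (hab : a ≠ b) (σ : Ranking q) :
    2 * #{τ | pref a b τ = pref a b σ} = q.factorial := by
  have h1 : #{τ | pref a b τ = pref a b σ} = #{τ | ¬ pref a b τ = pref a b σ} := by
    refine card_equiv (Equiv.mulLeft (Equiv.swap a b)) fun τ => ?_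
    rw [mem_filter_univ, mem_filter_univ, Equiv.coe_mulLeft, pref_swap_mul_self hab]
    cases pref a b τ <;> cases pref a b σ <;> simp
  have h2 := card_filter_add_card_filter_not (s := univ)
    (fun τ : Ranking q => pref a b τ = pref a b σ)
  rw [← h1, card_univ, Fintype.card_perm, Fintype.card_fin] at h2
  omega

theorem sum_ind_mul (p : Profile n q → Prop) (g : Profile n q) :
    ∑ x, ind (p (x * g)) = ∑ x, ind (p x) :=
  Equiv.sum_comp (Equiv.mulRight g) (fun x => ind (p x))

/-- The hypothesis `hτ` says that `σ` and `σ * τ` disagree on the pair at ranks `s`, `t`. As they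
agree on `a`, `b`, sorting never has to swap these two. -/
theorem pref_mul_swap_eq {σ τ : Ranking q} {a b s t : Fin q}
    (hst : (s : ℕ) + 1 = t) (hτ : τ.symm t < τ.symm s) (h : pref a b (σ * τ) = pref a b σ) :
    ¬ (σ s = a ∧ σ t = b) ∧ ¬ (σ s = b ∧ σ t = a) ∧
      pref a b (σ * Equiv.swap s t) = pref a b σ := by
  have hlt : s < t := by rw [Fin.lt_def]; omega
  have hsymm : ∀ c, (σ * τ).symm (σ c) = τ.symm c := by
    intro c; rw [Equiv.symm_apply_eq]; simp
  have k1 : ¬ (σ s = a ∧ σ t = b) := by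
    rintro ⟨rfl, rfl⟩
    simp [pref, hsymm, hlt, hτ.not_gt] at h
  have k2 : ¬ (σ s = b ∧ σ t = a) := by
    rintro ⟨rfl, rfl⟩
    simp [pref, hsymm, hlt.not_gt, hτ] at h
  refine ⟨k1, k2, ?_⟩
  simp only [pref, mul_swap_symm_apply]
  rw [decide_eq_decide]
  refine swap_lt_swap_iff hst ?_ ?_
  · rw [Equiv.symm_apply_eq, Equiv.symm_apply_eq]; exact fun h => k1 ⟨h.1.symm, h.2.symm⟩
  · rw [Equiv.symm_apply_eq, Equiv.symm_apply_eq]; exact fun h => k2 ⟨h.2.symm, h.1.symm⟩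

/-- Bubble sort leads from `x l` to `x l * σ` without swapping `a` and `b`, so a path from a
non-pivotal to a pivotal profile crosses the boundary at a square with a manipulable corner. The
four corners are translates of `x`, whence the factor 4. -/
theorem sum_pivotal_exit_le (hq : 4 ≤ q) {i l : Fin n} (hil : i ≠ l) {u v a b : Fin q}
    (huv : (u : ℕ) + 1 = v) (σ : Ranking q) :
    ∑ x, ind (¬ Pivotal f i u v a b x ∧ Pivotal f i u v a b (x * single l σ) ∧
        pref a b (x l * σ) = pref a b (x l)) ≤
      (q : ℝ) ^ 3 * (4 * ∑ x, ind (Manipulable f x)) := by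
  refine le_of_adjacent_swap_le (F := fun σ => ∑ x, ind (¬ Pivotal f i u v a b x ∧
    Pivotal f i u v a b (x * single l σ) ∧ pref a b (x l * σ) = pref a b (x l)))
    (mul_nonneg (by norm_num) (sum_nonneg fun _ _ => ind_nonneg _)) ?_ (fun σ s t hst hσ => ?_) σ
  · refine sum_nonpos fun x _ => (ind_of_not ?_).le
    rw [single_one, mul_one]
    tauto
  have e1 := sum_ind_mul (Manipulable f) (single l (Equiv.swap s t))
  have e2 := sum_ind_mul (Manipulable f) (single i (Equiv.swap u v))
  have e3 := (sum_ind_mul (fun x => Manipulable f (x * single i (Equiv.swap u v)))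
    (single l (Equiv.swap s t))).trans e2
  have e4 := sum_ind_mul (fun x => ¬ Pivotal f i u v a b x ∧
    Pivotal f i u v a b (x * single l (Equiv.swap s t * σ)) ∧
    pref a b (x l * (Equiv.swap s t * σ)) = pref a b (x l)) (single l (Equiv.swap s t))
  rw [← e4]
  have e5 : 4 * ∑ x, ind (Manipulable f x) = ∑ x, ind (Manipulable f x) +
      ∑ x, ind (Manipulable f (x * single l (Equiv.swap s t))) +
      ∑ x, ind (Manipulable f (x * single i (Equiv.swap u v))) +
      ∑ x, ind (Manipulable f (x * single l (Equiv.swap s t) * single i (Equiv.swap u v))) := by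
    rw [e1, e2, e3]; ring
  rw [e5, ← sum_add_distrib, ← sum_add_distrib, ← sum_add_distrib, ← sum_add_distrib]
  refine sum_le_sum fun x _ => ?_
  have n1 := ind_nonneg (Manipulable f x)
  have n2 := ind_nonneg (Manipulable f (x * single l (Equiv.swap s t)))
  have n3 := ind_nonneg (Manipulable f (x * single i (Equiv.swap u v)))
  have n4 := ind_nonneg
    (Manipulable f (x * single l (Equiv.swap s t) * single i (Equiv.swap u v)))
  refine ind_le_of_imp (add_nonneg (by positivity) (ind_nonneg _)) ?_
  rintro ⟨hx, hxσ, hp⟩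
  obtain ⟨k1, k2, k3⟩ := pref_mul_swap_eq hst hσ hp
  set y := x * single l (Equiv.swap s t) with hy
  have hyx : y * single l (Equiv.swap s t) = x := mul_single_swap_swap x l s t
  have hyl : y l = x l * Equiv.swap s t := mul_single_same x l _
  have hnn := ind_nonneg (¬ Pivotal f i u v a b y ∧
    Pivotal f i u v a b (y * single l (Equiv.swap s t * σ)) ∧
    pref a b (y l * (Equiv.swap s t * σ)) = pref a b (y l))
  by_cases hpy : Pivotal f i u v a b y
  · have := manipulable_of_pivotal_of_not_pivotal hq hil huv hst hpy (hyx ▸ hx)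
      (by rw [hyl]; simpa [and_comm] using k2) (by rw [hyl]; simpa [and_comm] using k1)
    rw [hyx] at this
    rcases this with h | h | h | h <;> linarith [ind_of h]
  · have h1 : y * single l (Equiv.swap s t * σ) = x * single l σ := by
      rw [single_mul, ← mul_assoc, hyx]
    have h2 : y l * (Equiv.swap s t * σ) = x l * σ := by
      rw [hyl, mul_assoc, ← mul_assoc (Equiv.swap s t), Equiv.swap_mul_self, one_mul]
    have : ind (¬ Pivotal f i u v a b y ∧
      Pivotal f i u v a b (y * single l (Equiv.swap s t * σ)) ∧
      pref a b (y l * (Equiv.swap s t * σ)) = pref a b (y l)) = 1 :=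
      ind_of ⟨hpy, by rwa [h1], by rw [h2, hp, hyl, k3]⟩
    linarith

/-- A preference class has `q! / 2` rankings, which doubles the 4 of `sum_pivotal_exit_le`. -/
theorem sum_one_sub_mul_avg_le (hq : 4 ≤ q) {i l : Fin n} (hil : i ≠ l) {u v a b : Fin q}
    (huv : (u : ℕ) + 1 = v) (hab : a ≠ b) :
    ∑ x, (1 - ind (Pivotal f i u v a b x)) *
        avg (pref a b) l (fun x => ind (Pivotal f i u v a b x)) x ≤
      8 * (q : ℝ) ^ 3 * ∑ x, ind (Manipulable f x) := by
  have hfac : (0 : ℝ) < q.factorial := by exact_mod_cast q.factorial_pos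
  have h1 : ∀ x, (1 - ind (Pivotal f i u v a b x)) *
        avg (pref a b) l (fun x => ind (Pivotal f i u v a b x)) x =
      2 / q.factorial * ∑ σ, ind (¬ Pivotal f i u v a b x ∧
        Pivotal f i u v a b (x * single l σ) ∧ pref a b (x l * σ) = pref a b (x l)) := by
    intro x
    have hc : (2 : ℝ) * #{τ | pref a b τ = pref a b (x l)} = q.factorial := by
      exact_mod_cast card_pref_class hab (x l)
    have hpos := card_class_pos (pref a b) (x l)
    have hdiv : (2 : ℝ) / q.factorial = 1 / #{τ | pref a b τ = pref a b (x l)} := by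
      rw [← hc]; field_simp
    rw [avg, hdiv, mul_div_assoc', ← one_div_mul_eq_div, sum_filter,
      ← Equiv.sum_comp (Equiv.mulLeft (x l)), mul_sum]
    congr 1
    refine sum_congr rfl fun σ _ => ?_
    rw [Equiv.coe_mulLeft, ← mul_single_eq_update]
    by_cases k1 : Pivotal f i u v a b x <;>
    by_cases k2 : Pivotal f i u v a b (x * single l σ) <;>
    by_cases k3 : pref a b (x l * σ) = pref a b (x l) <;> simp [ind, k1, k2, k3]
  simp_rw [h1]
  rw [← mul_sum, sum_comm, div_mul_eq_mul_div, div_le_iff₀ hfac]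
  calc 2 * ∑ σ : Ranking q, ∑ x, ind (¬ Pivotal f i u v a b x ∧
        Pivotal f i u v a b (x * single l σ) ∧ pref a b (x l * σ) = pref a b (x l))
      ≤ 2 * ∑ _σ : Ranking q, (q : ℝ) ^ 3 * (4 * ∑ x, ind (Manipulable f x)) := by
        refine mul_le_mul_of_nonneg_left (sum_le_sum fun σ _ => ?_) (by norm_num)
        exact sum_pivotal_exit_le hq hil huv σ
    _ = _ := by
        rw [sum_const, card_univ, Fintype.card_perm, Fintype.card_fin, nsmul_eq_mul]
        ring

end Manipulation

/-! ### Neutrality, independence of two pivotal voters, and the final count. -/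

section Neutrality

variable {n q : ℕ} {f : SCF n q}

theorem mul_left_mul_single (x : Profile n q) (y : Ranking q) (i : Fin n) (σ : Ranking q) :
    (fun l => y * x l) * single i σ = fun l => y * (x * single i σ) l := by
  funext l; simp [mul_assoc]

theorem Neutral.pivotal_iff (hf : Neutral f) {i : Fin n} {u v a b : Fin q} {y : Ranking q}
    (ha : y a = a) (hb : y b = b) (x : Profile n q) :
    Pivotal f i u v a b (fun l => y * x l) ↔ Pivotal f i u v a b x := by
  have h1 : ∀ c, y c = a ↔ c = a := fun c => by
    conv_lhs => rw [← ha, y.injective.eq_iff]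
  have h2 : ∀ c, y c = b ↔ c = b := fun c => by
    conv_lhs => rw [← hb, y.injective.eq_iff]
  rw [Pivotal, mul_left_mul_single, ← hf, ← hf]
  simp only [Equiv.Perm.coe_mul, comp_apply, h1, h2, Pivotal]

theorem exists_perm_apply_eq {a b a' b' : Fin q} (hab : a ≠ b) (hab' : a' ≠ b') :
    ∃ y : Ranking q, y a = a' ∧ y b = b' := by
  refine ⟨Equiv.swap (Equiv.swap a a' b) b' * Equiv.swap a a', ?_, by simp⟩
  have h : a' ≠ Equiv.swap a a' b := by
    intro h
    have : Equiv.swap a a' a = Equiv.swap a a' b := by rw [Equiv.swap_apply_left, ← h]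
    exact hab ((Equiv.swap a a').injective this)
  simp [Equiv.swap_apply_of_ne_of_ne h hab']

theorem Neutral.sum_outcomes_eq (hf : Neutral f) (g : Profile n q) {a b a' b' : Fin q}
    (hab : a ≠ b) (hab' : a' ≠ b') :
    ∑ x, ind (f x = a ∧ f (x * g) = b) = ∑ x, ind (f x = a' ∧ f (x * g) = b') := by
  obtain ⟨y, rfl, rfl⟩ := exists_perm_apply_eq hab hab'
  rw [← Equiv.sum_comp (Equiv.mulLeft (fun _ : Fin n => y))
    (fun x => ind (f x = y a ∧ f (x * g) = y b))]
  refine sum_congr rfl fun x _ => ?_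
  have h1 : Equiv.mulLeft (fun _ : Fin n => y) x = fun l => y * x l := rfl
  have h2 : (fun l => y * x l) * g = fun l => y * (x * g) l := by
    funext l; simp [mul_assoc]
  rw [h1, h2, ← hf, ← hf, y.injective.eq_iff, y.injective.eq_iff]

/-- There are at most `q ^ 2` ordered pairs of distinct outcomes, all equally frequent by
neutrality. -/
theorem Neutral.changes_le (hf : Neutral f) (g : Profile n q) {a b : Fin q} (hab : a ≠ b) :
    changes f g ≤ (q : ℝ) ^ 2 * ∑ x, ind (f x = a ∧ f (x * g) = b) := by
  have h1 : ∀ x, ind (f x ≠ f (x * g)) ≤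
      ∑ a', ∑ b', if a' ≠ b' then ind (f x = a' ∧ f (x * g) = b') else 0 := by
    intro x
    have hnn : ∀ a' b', (0 : ℝ) ≤ if a' ≠ b' then ind (f x = a' ∧ f (x * g) = b') else 0 := by
      intro a' b'; split_ifs; exacts [ind_nonneg _, le_rfl]
    refine ind_le_of_imp (sum_nonneg fun a' _ => sum_nonneg fun b' _ => hnn a' b') fun h => ?_
    refine le_trans ?_ (single_le_sum (fun a' _ => sum_nonneg fun b' _ => hnn a' b')
      (mem_univ (f x)))
    refine le_trans ?_ (single_le_sum (fun b' _ => hnn (f x) b') (mem_univ (f (x * g))))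
    rw [if_pos h, ind_of ⟨rfl, rfl⟩]
  have hnn : 0 ≤ ∑ x, ind (f x = a ∧ f (x * g) = b) := sum_nonneg fun _ _ => ind_nonneg _
  calc changes f g ≤ ∑ x, ∑ a', ∑ b', if a' ≠ b' then ind (f x = a' ∧ f (x * g) = b') else 0 :=
        sum_le_sum fun x _ => h1 x
    _ = ∑ a', ∑ b', ∑ x, if a' ≠ b' then ind (f x = a' ∧ f (x * g) = b') else 0 := by
        rw [sum_comm]; exact sum_congr rfl fun a' _ => sum_comm
    _ ≤ ∑ _a' : Fin q, ∑ _b' : Fin q, ∑ x, ind (f x = a ∧ f (x * g) = b) := by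
        refine sum_le_sum fun a' _ => sum_le_sum fun b' _ => ?_
        by_cases h : a' = b'
        · simpa [h] using hnn
        · simp only [ne_eq, h, not_false_eq_true, if_true]
          exact (hf.sum_outcomes_eq g h hab).le
    _ = _ := by simp; ring

/-- In a neutral function, an influential adjacent swap is pivotal for every pair of
alternatives. -/
theorem Neutral.changes_le_pivotal (hf : Neutral f) (hq : 4 ≤ q) (i : Fin n) {u v a b : Fin q}
    (huv : (u : ℕ) + 1 = v) (hab : a ≠ b) :
    changes f (single i (Equiv.swap u v)) ≤ (q : ℝ) ^ 2 *
      (∑ x, ind (Pivotal f i u v a b x) + 2 * ∑ x, ind (Manipulable f x)) := by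
  refine (hf.changes_le _ hab).trans (mul_le_mul_of_nonneg_left ?_ (by positivity))
  have e1 := sum_ind_mul (Manipulable f) (single i (Equiv.swap u v))
  rw [two_mul]
  nth_rw 2 [← e1]
  rw [← sum_add_distrib, ← sum_add_distrib]
  refine sum_le_sum fun x _ => ?_
  have n1 := ind_nonneg (Manipulable f x)
  have n2 := ind_nonneg (Manipulable f (x * single i (Equiv.swap u v)))
  have n3 := ind_nonneg (Pivotal f i u v a b x)
  refine ind_le_of_imp (by positivity) fun h => ?_
  by_cases h1 : Manipulable f x
  · linarith [ind_of h1]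
  by_cases h2 : Manipulable f (x * single i (Equiv.swap u v))
  · linarith [ind_of h2]
  have h3 := eq_of_changed hq huv h1 h2 (by rw [h.1, h.2]; exact hab)
  rw [h.1, h.2] at h3
  have h4 : Pivotal f i u v a b x := ⟨h3.1, h3.2, h.1, h.2⟩
  linarith [ind_of h4]

theorem sum_avgs_pivotal_exit_le (hq : 4 ≤ q) {i : Fin n} {u v a b : Fin q}
    (huv : (u : ℕ) + 1 = v) (hab : a ≠ b) :
    ∑ x, (1 - ind (Pivotal f i u v a b x)) * avgs (pref a b) (univ.erase i).toList
        (fun x => ind (Pivotal f i u v a b x)) x ≤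
      8 * n * (q : ℝ) ^ 3 * ∑ x, ind (Manipulable f x) := by
  refine (sum_one_sub_mul_avgs_le (fun x => ?_) _).trans ?_
  · by_cases h : Pivotal f i u v a b x
    · exact Or.inr (ind_of h)
    · exact Or.inl (ind_of_not h)
  have hm : 0 ≤ ∑ x, ind (Manipulable f x) := sum_nonneg fun _ _ => ind_nonneg _
  refine (List.sum_le_card_nsmul _ (8 * (q : ℝ) ^ 3 * ∑ x, ind (Manipulable f x)) ?_).trans ?_
  · intro t ht
    obtain ⟨l, hl, rfl⟩ := List.mem_map.1 ht
    exact sum_one_sub_mul_avg_le hq (ne_of_mem_erase (mem_toList.1 hl)).symm huv hab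
  · rw [List.length_map, length_toList, nsmul_eq_mul]
    have : (#(univ.erase i) : ℝ) ≤ n := by
      exact_mod_cast (card_le_univ _).trans (by simp)
    calc (#(univ.erase i) : ℝ) * (8 * (q : ℝ) ^ 3 * ∑ x, ind (Manipulable f x))
        ≤ n * (8 * (q : ℝ) ^ 3 * ∑ x, ind (Manipulable f x)) := by gcongr
      _ = _ := by ring

/-- Two voters being pivotal for disjoint pairs of alternatives entails manipulability. -/
theorem Neutral.sum_pivotal_mul_sum_pivotal_le (hf : Neutral f) (hq : 4 ≤ q) {i j : Fin n}
    (hij : i ≠ j) {u v s t a b c d : Fin q} (huv : (u : ℕ) + 1 = v) (hst : (s : ℕ) + 1 = t)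
    (hab : a ≠ b) (hcd : c ≠ d) (hac : a ≠ c) (had : a ≠ d) (hbc : b ≠ c) (hbd : b ≠ d) :
    (∑ x, ind (Pivotal f i u v a b x)) * ∑ x, ind (Pivotal f j s t c d x) ≤
      Fintype.card (Profile n q) * (16 * n * (q : ℝ) ^ 3 * ∑ x, ind (Manipulable f x)) := by
  set A : Profile n q → ℝ := fun x => ind (Pivotal f i u v a b x) with hA
  set C : Profile n q → ℝ := fun x => ind (Pivotal f j s t c d x) with hC
  set g := avgs (pref a b) (univ.erase i).toList A with hg
  set g' := avgs (pref c d) (univ.erase j).toList C with hg'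
  have hAe : ∀ x : Profile n q, A (fun l => Equiv.mulLeft (Equiv.swap c d) (x l)) = A x := by
    intro x
    change ind _ = ind _
    congr 1
    exact propext (hf.pivotal_iff (Equiv.swap_apply_of_ne_of_ne hac had)
      (Equiv.swap_apply_of_ne_of_ne hbc hbd) x)
  have hCe : ∀ x : Profile n q, C (fun l => Equiv.mulLeft (Equiv.swap a b) (x l)) = C x := by
    intro x
    change ind _ = ind _
    congr 1
    exact propext (hf.pivotal_iff (Equiv.swap_apply_of_ne_of_ne hac.symm hbc.symm)
      (Equiv.swap_apply_of_ne_of_ne had.symm hbd.symm) x)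
  -- The voter `i`'s own ranking was not averaged in `g`; averaging it over its `c`-`d` class leaves
  -- no dependence on it, by neutrality under the swap of `c` and `d`.
  have hG : ∀ x y : Profile n q, (∀ l, pref a b (y l) = pref a b (x l)) →
      avg (pref c d) i g y = avg (pref c d) i g x := fun x y hxy =>
    avg_avgs_eq (e := Equiv.mulLeft (Equiv.swap c d)) (pref_swap_mul_of_ne hac had hbc hbd)
      (pref_swap_mul_self hcd) hAe (by simp) fun l _ => hxy l
  have hG' : ∀ x y : Profile n q, (∀ l, pref c d (y l) = pref c d (x l)) →
      avg (pref a b) j g' y = avg (pref a b) j g' x := fun x y hxy =>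
    avg_avgs_eq (e := Equiv.mulLeft (Equiv.swap a b))
      (pref_swap_mul_of_ne hac.symm hbc.symm had.symm hbd.symm)
      (pref_swap_mul_self hab) hCe (by simp) fun l _ => hxy l
  have hind := sum_mul_sum_of_flip (n := n) (e := fun σ : Ranking q => Equiv.swap c d * σ)
    (fun σ => by simp [← mul_assoc]) (pref_swap_mul_of_ne hac had hbc hbd)
    (pref_swap_mul_self hcd) hG hG'
  rw [sum_avg, sum_avg, hg, hg', sum_avgs, sum_avgs, ← hg, ← hg'] at hind
  rw [hind]
  refine mul_le_mul_of_nonneg_left ?_ (Nat.cast_nonneg _)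
  have hdg : DependsOnClass (pref a b) j g := dependsOnClass_avgs (by simp [hij.symm])
  have hdg' : DependsOnClass (pref c d) i g' := dependsOnClass_avgs (by simp [hij])
  -- The extra averages do not affect the product: `g` already depends on the coordinate `j` only
  -- through its `a`-`b` class, and `g'` on `i` only through its `c`-`d` class.
  have h1 : ∑ x, avg (pref c d) i g x * avg (pref a b) j g' x = ∑ x, g x * g' x := by
    have e1 : ∀ x, avg (pref c d) i g x * avg (pref a b) j g' x =
        avg (pref a b) j (fun y => g' y * avg (pref c d) i g y) x := fun x => by
      rw [avg_mul_of_dependsOnClass (hdg.avg hij.symm), mul_comm]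
    simp_rw [e1]
    rw [sum_avg]
    have e2 : ∀ x, g' x * avg (pref c d) i g x =
        avg (pref c d) i (fun y => g y * g' y) x := fun x => by
      rw [avg_mul_of_dependsOnClass hdg', mul_comm]
    simp_rw [e2]
    rw [sum_avg]
  rw [h1]
  have b1 := sum_avgs_pivotal_exit_le (f := f) (i := i) hq huv hab
  have b2 := sum_avgs_pivotal_exit_le (f := f) (i := j) hq hst hcd
  have b3 : ∑ x, g x * g' x ≤ ∑ x, (1 - A x) * g x + ∑ x, (1 - C x) * g' x := by
    rw [← sum_add_distrib]
    refine sum_le_sum fun x _ => ?_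
    have g0 : 0 ≤ g x := avgs_nonneg _ (fun _ => ind_nonneg _) x
    have g1 : g x ≤ 1 := avgs_le_one _ (fun _ => ind_le_one _) x
    have g0' : 0 ≤ g' x := avgs_nonneg _ (fun _ => ind_nonneg _) x
    have g1' : g' x ≤ 1 := avgs_le_one _ (fun _ => ind_le_one _) x
    have hA1 : A x ≤ 1 := ind_le_one _
    have hC1 : C x ≤ 1 := ind_le_one _
    by_cases hx : Pivotal f i u v a b x
    -- The two pivotal events are disjoint, because the outcome would be both `a` and `c`.
    · have : C x = 0 := ind_of_not fun hx' => hac (hx.2.2.1.symm.trans hx'.2.2.1)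
      rw [this]
      nlinarith [mul_nonneg (sub_nonneg.2 hA1) g0]
    · have : A x = 0 := ind_of_not hx
      rw [this]
      nlinarith [mul_nonneg (sub_nonneg.2 hC1) g0']
  refine (b3.trans (add_le_add b1 b2)).trans (le_of_eq ?_)
  ring

theorem sum_manipulable_le :
    ∑ x, ind (Manipulable f x) ≤
      ∑ ω : Sample n q, ind (IsManipulationPair f (Sample.X ω) (Sample.Y ω)) := by
  rw [Fintype.sum_prod_type]
  refine sum_le_sum fun x _ => ?_
  refine ind_le_of_imp (sum_nonneg fun _ _ => ind_nonneg _) ?_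
  rintro ⟨i, k, π, h⟩
  refine le_trans ?_ (single_le_sum (fun _ _ => ind_nonneg _) (mem_univ (i, k, π)))
  exact (ind_of h).ge

theorem card_sample : (Fintype.card (Sample n q) : ℝ) =
    Fintype.card (Profile n q) * (n * ((q - 3 : ℕ) * 24)) := by
  rw [Fintype.card_prod, Fintype.card_prod, Fintype.card_prod, Fintype.card_fin, Fintype.card_fin,
    Fintype.card_perm, Fintype.card_fin]
  norm_num [Nat.factorial]

theorem distanceTo_DICT_le_one (i : Fin n) : distanceTo f (DICT n q) ≤ 1 := by
  have hN : (0 : ℝ) < Fintype.card (Profile n q) := by exact_mod_cast Fintype.card_pos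
  have hle : distanceTo f (DICT n q) ≤ distance f (fun x => f (update 1 i (x i))) := by
    refine csInf_le ⟨0, ?_⟩ ⟨_, ?_, rfl⟩
    · rintro _ ⟨g, -, rfl⟩
      exact div_nonneg (Nat.cast_nonneg _) (Nat.cast_nonneg _)
    · refine Set.mem_iUnion.2 ⟨i, fun x y hxy => ?_⟩
      change f _ = f _
      rw [hxy]
  refine hle.trans ?_
  rw [distance, uniformProb_eq, div_le_one hN]
  exact (sum_le_sum fun _ _ => ind_le_one _).trans (by simp)

/-- Otherwise `distanceTo_DICT_le` would give distance at most `ε / 2`; the 2 in the threshold makes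
this contradict `hdist`. -/
theorem exists_influential {ε : ℝ} (hε : 0 < ε) (hn : 0 < n) (hq : 0 < q)
    (hdist : ε ≤ distanceTo f (DICT n q)) (i : Fin n) :
    ∃ j, j ≠ i ∧ ∃ u v : Fin q, (u : ℕ) + 1 = v ∧
      ε / (2 * n * (q : ℝ) ^ 3) * Fintype.card (Profile n q) ≤
        changes f (single j (Equiv.swap u v)) := by
  have hN : (0 : ℝ) < Fintype.card (Profile n q) := by exact_mod_cast Fintype.card_pos
  have hn' : (0 : ℝ) < n := by exact_mod_cast hn
  have hq' : (0 : ℝ) < q := by exact_mod_cast hq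
  by_contra! hcon
  have h := distanceTo_DICT_le f i (η := ε / (2 * n * (q : ℝ) ^ 3) * Fintype.card (Profile n q))
    (by positivity) fun j hj u v huv => (hcon j hj u v huv).le
  have h2 : n * ((q : ℝ) ^ 3 * (ε / (2 * n * (q : ℝ) ^ 3) * Fintype.card (Profile n q))) =
      ε / 2 * Fintype.card (Profile n q) := by field_simp
  rw [h2] at h
  have := le_of_mul_le_mul_right h hN
  linarith

theorem Neutral.le_sum_manipulable (hf : Neutral f) (hq : 4 ≤ q) {ε : ℝ} (hε : 0 < ε)
    (hn : 0 < n) (hdist : ε ≤ distanceTo f (DICT n q)) :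
    ε ^ 2 / (256 * (n : ℝ) ^ 3 * (q : ℝ) ^ 13) * Fintype.card (Profile n q) ≤
      ∑ x, ind (Manipulable f x) := by
  have hN : (0 : ℝ) < Fintype.card (Profile n q) := by exact_mod_cast Fintype.card_pos
  have hn1 : (1 : ℝ) ≤ n := by exact_mod_cast hn
  have hq1 : (1 : ℝ) ≤ q := by exact_mod_cast (by omega : 1 ≤ q)
  -- The excluded voter is arbitrary here; the next line excludes `i` to get a second voter.
  obtain ⟨i, -, u, v, huv, hi⟩ := exists_influential hε hn (by omega) hdist ⟨0, hn⟩
  obtain ⟨j, hji, s, t, hst, hj⟩ := exists_influential hε hn (by omega) hdist i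
  have hε1 : ε ≤ 1 := hdist.trans (distanceTo_DICT_le_one i)
  let a : Fin q := ⟨0, by omega⟩
  let b : Fin q := ⟨1, by omega⟩
  let c : Fin q := ⟨2, by omega⟩
  let d : Fin q := ⟨3, by omega⟩
  have hprod := hf.sum_pivotal_mul_sum_pivotal_le hq hji.symm huv hst (a := a) (b := b) (c := c)
    (d := d) (by simp [a, b]) (by simp [c, d]) (by simp [a, c]) (by simp [a, d])
    (by simp [b, c]) (by simp [b, d])
  have hA := hi.trans (hf.changes_le_pivotal hq i huv (a := a) (b := b) (by simp [a, b]))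
  have hC := hj.trans (hf.changes_le_pivotal hq j hst (a := c) (b := d) (by simp [c, d]))
  set m := ∑ x, ind (Manipulable f x)
  set A := ∑ x, ind (Pivotal f i u v a b x)
  set C := ∑ x, ind (Pivotal f j s t c d x)
  set N := (Fintype.card (Profile n q) : ℝ)
  have hnpos : (0 : ℝ) < n := by linarith
  have hqpos : (0 : ℝ) < q := by linarith
  have hsplit : ∀ z : ℝ, ε / (2 * n * (q : ℝ) ^ 3) * N ≤ (q : ℝ) ^ 2 * (z + 2 * m) →
      2 * (ε / (4 * n * (q : ℝ) ^ 5) * N) ≤ z + 2 * m := by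
    intro z hz
    have e : ε / (2 * n * (q : ℝ) ^ 3) * N =
        (q : ℝ) ^ 2 * (2 * (ε / (4 * n * (q : ℝ) ^ 5) * N)) := by field_simp; norm_num
    rw [e] at hz
    exact le_of_mul_le_mul_left hz (by positivity)
  have hA' := hsplit A hA
  have hC' := hsplit C hC
  set δ := ε / (4 * n * (q : ℝ) ^ 5) * N with hδ
  have hδ0 : 0 < δ := by positivity
  -- If `2 * m ≤ δ`, both pivotal counts are at least `2 * δ - 2 * m ≥ δ` and the product bound
  -- applies. Otherwise `m ≥ δ / 2`, which is more than enough since `ε ≤ 1`.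
  rcases le_total (2 * m) δ with hm | hm
  · have h1 : δ * δ ≤ A * C := mul_le_mul (by linarith) (by linarith) hδ0.le (by linarith)
    have h2 := h1.trans hprod
    have e : δ * δ = N * (16 * n * (q : ℝ) ^ 3 *
        (ε ^ 2 / (256 * (n : ℝ) ^ 3 * (q : ℝ) ^ 13) * N)) := by
      rw [hδ]; field_simp; norm_num
    rw [e] at h2
    exact le_of_mul_le_mul_left (le_of_mul_le_mul_left h2 hN) (by positivity)
  · have h1 : ε ^ 2 / (256 * (n : ℝ) ^ 3 * (q : ℝ) ^ 13) ≤ ε / (8 * n * (q : ℝ) ^ 5) := by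
      have hd : 8 * n * (q : ℝ) ^ 5 ≤ 256 * (n : ℝ) ^ 3 * (q : ℝ) ^ 13 := by
        gcongr
        · norm_num
        · exact le_self_pow₀ hn1 (by norm_num)
        · norm_num
      exact div_le_div₀ hε.le (by nlinarith) (by positivity) hd
    have h2 : ε / (8 * n * (q : ℝ) ^ 5) * N = δ / 2 := by rw [hδ]; field_simp; norm_num
    have h3 := mul_le_mul_of_nonneg_right h1 hN.le
    linarith

end Neutrality

end SocialChoice

open SocialChoice in
theorem corollary4 (n q : ℕ) (hq : 4 ≤ q) (f : SocialChoice.SCF n q)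
    (hf : SocialChoice.Neutral f) (ε : ℝ) (hε : 0 ≤ ε)
    (hdist : ε ≤ SocialChoice.distanceTo f (SocialChoice.DICT n q)) :
    ε ^ 2 / (10 ^ 9 * (n : ℝ) ^ 4 * (q : ℝ) ^ 34) ≤
      SocialChoice.uniformProb (SocialChoice.Sample n q)
        (fun ω => SocialChoice.IsManipulationPair f
          (SocialChoice.Sample.X ω) (SocialChoice.Sample.Y ω)) := by
  have h0 : 0 ≤ uniformProb (Sample n q)
      (fun ω => IsManipulationPair f (Sample.X ω) (Sample.Y ω)) :=
    div_nonneg (Nat.cast_nonneg _) (Nat.cast_nonneg _)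
  rcases hε.eq_or_lt with rfl | hε
  · simpa using h0
  -- For `n = 0` the bound is a division by zero, hence 0.
  rcases Nat.eq_zero_or_pos n with rfl | hn
  · simpa using h0
  have hN : (0 : ℝ) < Fintype.card (Profile n q) := by exact_mod_cast Fintype.card_pos
  have hn0 : (0 : ℝ) < n := by exact_mod_cast hn
  have hq1 : (1 : ℝ) ≤ q := by exact_mod_cast (by omega : 1 ≤ q)
  have hq0 : (0 : ℝ) < q := by linarith
  have hq3 : (0 : ℝ) < (q - 3 : ℕ) := by exact_mod_cast (by omega : 0 < q - 3)
  have hq3' : ((q - 3 : ℕ) : ℝ) ≤ q := by exact_mod_cast Nat.sub_le q 3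
  rw [uniformProb_eq, card_sample, le_div_iff₀ (by positivity)]
  refine le_trans ?_ ((hf.le_sum_manipulable hq hε hn hdist).trans sum_manipulable_le)
  -- One good choice of voter, block and permutation per manipulable profile costs `n * (q - 3) *
  -- 24`; `6144 = 256 * 24`, so the stated constants leave ample room.
  calc ε ^ 2 / (10 ^ 9 * (n : ℝ) ^ 4 * (q : ℝ) ^ 34) *
        (Fintype.card (Profile n q) * (n * ((q - 3 : ℕ) * 24)))
      ≤ ε ^ 2 / (6144 * (n : ℝ) ^ 4 * (q : ℝ) ^ 14) *
        (Fintype.card (Profile n q) * (n * (q * 24))) := by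
        gcongr
        · norm_num
        · norm_num
    _ = _ := by field_simp; norm_num
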